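/- Let $n\ge k\ge 1$ be integers and $\pm[n]=\{\pm1,\dots,\pm n\}$. A signed $k$-subset of $[n]$ is a $k$-element set $A\subseteq \pm[n]$ with $A\cap(-A)=\emptyset$, where $-A=\{-a: a\in A\}$. The Kneser signed graph $\mathrm{KS}(n,k)$ has the signed $k$-subsets of $[n]$ as its vertices; $A$ and $B$ are joined by a positive edge if $A\cap(-B)=\emptyset$, and by a negative edge if $A\cap B=\emptyset$ (both edges may be present). The Schrijver signed graph $\mathrm{SSG}(n,k)$ is the subgraph of $\mathrm{KS}(n,k)$ induced by the alternating signed $k$-subsets, i.e. those of the form $\{a_1,-a_2,\dots,(-1)^{k-1}a_k\}$ or $\{-a_1,a_2,\dots,(-1)^{k}a_k\}$ with $1\le a_1<a_2<\dots<a_k\le n$. For a signed graph $G$ let $G^-$ be the graph formed by its negative edges, and let $\chi$ denote the chromatic number. Then $$\chi(\mathrm{KS}(n,k)^-)=2n-2k+2,$$ and, if $k\ge 2$ or $n=k$, $$\chi(\mathrm{SSG}(n,k)^-)=n-k+2.$$ -/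

import Mathlib

/-- A signed graph on the vertex set `V`: a symmetric relation of positive edges and a symmetric
relation of negative edges. Loops are allowed, and two vertices may be joined both by a positive
and by a negative edge. -/
structure SignedGraph (V : Type*) where
  /-- being joined by a positive edge -/
  posAdj : V → V → Prop
  /-- being joined by a negative edge -/
  negAdj : V → V → Prop
  posAdj_symm : ∀ u v, posAdj u v → posAdj v u
  negAdj_symm : ∀ u v, negAdj u v → negAdj v u

namespace SignedGraph

/-- The signed subgraph induced by a set of vertices, with the inherited signs. -/
def induce {V : Type*} (G : SignedGraph V) (s : Set V) : SignedGraph s where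
  posAdj u v := G.posAdj u v
  negAdj u v := G.negAdj u v
  posAdj_symm u v h := G.posAdj_symm u v h
  negAdj_symm u v h := G.negAdj_symm u v h

/-- The graph formed by the negative edges of a signed graph. A `SimpleGraph` has no loops, so
this is meant for signed graphs without negative loops. -/
def negGraph {V : Type*} (G : SignedGraph V) : SimpleGraph V where
  Adj u v := u ≠ v ∧ G.negAdj u v
  symm := ⟨fun u v h => ⟨h.1.symm, G.negAdj_symm u v h.2⟩⟩
  loopless := ⟨fun _ h => h.1 rfl⟩

end SignedGraph

/-- The set `±[n] = {±1, …, ±n}`. -/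
def pmSet (n : ℕ) : Finset ℤ :=
  (Finset.Icc 1 n).image (fun i : ℕ => (i : ℤ)) ∪ (Finset.Icc 1 n).image (fun i : ℕ => -(i : ℤ))

/-- The set `-A = {-a : a ∈ A}`. -/
def negSet (A : Finset ℤ) : Finset ℤ := A.image (fun a => -a)

/-- `A` is a signed `k`-subset of `[n]`: a `k`-subset of `±[n]` with `A ∩ (-A) = ∅`. -/
def IsSignedSubset (n k : ℕ) (A : Finset ℤ) : Prop :=
  A ⊆ pmSet n ∧ A.card = k ∧ Disjoint A (negSet A)

/-- The type of signed `k`-subsets of `[n]`. -/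
abbrev SignedSubset (n k : ℕ) : Type := {A : Finset ℤ // IsSignedSubset n k A}

theorem disjoint_negSet_symm {A B : Finset ℤ} (h : Disjoint A (negSet B)) :
    Disjoint B (negSet A) := by
  rw [Finset.disjoint_left] at h ⊢
  intro b hb hb'
  obtain ⟨a, ha, rfl⟩ := Finset.mem_image.1 hb'
  exact h ha (Finset.mem_image.2 ⟨-a, hb, neg_neg a⟩)

/-- The Kneser signed graph `KS(n, k)`: signed `k`-subsets `A`, `B` of `[n]` are joined by a
positive edge if `A ∩ (-B) = ∅`, and by a negative edge if `A ∩ B = ∅`. -/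
def KS (n k : ℕ) : SignedGraph (SignedSubset n k) where
  posAdj A B := Disjoint A.1 (negSet B.1)
  negAdj A B := Disjoint A.1 B.1
  posAdj_symm _ _ h := disjoint_negSet_symm h
  negAdj_symm _ _ h := h.symm

/-- For `k ≥ 1` the Kneser signed graph has no negative loops. -/
theorem KS_no_negative_loop {n k : ℕ} (hk : 1 ≤ k) (A : SignedSubset n k) :
    ¬ (KS n k).negAdj A A := by
  intro h
  have h0 : A.1 = ∅ := Finset.disjoint_self_iff_empty A.1 |>.1 h
  have h1 := A.2.2.1
  rw [h0, Finset.card_empty] at h1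
  omega

/-- `A` is alternating: for some `1 ≤ a₁ < a₂ < ⋯ < aₖ ≤ n`, either
`A = {a₁, -a₂, …, (-1)^(k-1) aₖ}` or `A = {-a₁, a₂, …, (-1)^k aₖ}`.
(Here `aᵢ` is indexed from `0`.) -/
def IsAlternating (n k : ℕ) (A : Finset ℤ) : Prop :=
  ∃ a : Fin k → ℕ, StrictMono a ∧ (∀ i, 1 ≤ a i ∧ a i ≤ n) ∧
    (A = Finset.univ.image (fun i : Fin k => (-1 : ℤ) ^ (i : ℕ) * (a i : ℤ)) ∨
     A = Finset.univ.image (fun i : Fin k => (-1 : ℤ) ^ ((i : ℕ) + 1) * (a i : ℤ)))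

/-- The family of alternating signed `k`-subsets of `[n]`. -/
def alternatingSets (n k : ℕ) : Set (SignedSubset n k) := {A | IsAlternating n k A.1}

/-- The Schrijver signed graph `SSG(n, k)`: the subgraph of `KS(n, k)` induced by the alternating
signed `k`-subsets of `[n]`. -/
def SSG (n k : ℕ) : SignedGraph (alternatingSets n k) := (KS n k).induce (alternatingSets n k)

/-! Upper bounds: a set of integers meeting every vertex gives a colouring, since vertices that pick
the same element are not disjoint. For `KS` the set is `±[n-k]` with `±n`; for `SSG` with `k ≥ 2` it
consists of the positive integers up to `n-k+2`, while `n = k` is inherited from `KS`.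

Lower bounds are topological. `octahedral_tucker` says that an antipodal labelling of nonzero sign
vectors, with no opposite labels on comparable vectors, uses at least as many absolute values as
there are coordinates. It follows from Ky Fan's parity count `sum_chainWeight_eq_one`, an induction
over hemispheres. `le_add_of_alternation_cover` labels vectors of small alternation by that
alternation and the others by the least colour found in `X` or `-X`. For `KS` the `2n` coordinates
are the elements of `±[n]`, and alternation `2k-1` forces a signed `k`-subset into the positive
part. For `SSG` the `n` coordinates carry signs directly; alternation `k` yields vertices in both
`X` and `-X`, whose colours differ, so the smaller one avoids the top colour. This saves one label.
-/

/-! ### Alternating lists of signed labels, modulo 2 -/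

/-- Labels `±j`, ordered by absolute value first. -/
abbrev SignedLabel : Type := ℕ ×ₗ Bool

/-- The opposite label. -/
def SignedLabel.flip (x : SignedLabel) : SignedLabel := toLex ((ofLex x).1, !(ofLex x).2)

/-- The indicator of the lists of labels whose signs alternate and start with `b`. -/
def alternatingSign : Bool → List SignedLabel → ZMod 2
  | _, [] => 1
  | b, c :: l => if (ofLex c).2 = b then alternatingSign (!b) l else 0

/-- A nonempty list alternating from `b` survives only deletion of its last entry, one alternating
from `!b` only deletion of its first. In any other list the good deletions come in pairs, at two
adjacent equal signs. The empty list contributes `1 + 1 = 0`. -/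
theorem alternatingSign_sum_erase (b : Bool) (l : List SignedLabel) (hl : l.Pairwise (· ≤ ·)) :
    (l.map fun x => alternatingSign b (l.erase x)).sum =
      alternatingSign b l + alternatingSign (!b) l := by
  induction l generalizing b with
  | nil => simp [alternatingSign]; decide
  | cons c t ih =>
    rw [List.pairwise_cons] at hl
    -- `erase` removes the first occurrence; when `x` equals the head, sortedness makes the next
    -- entry equal too, so removing either copy gives the same list.
    have key : ∀ x ∈ t, (c :: t).erase x = c :: t.erase x := by
      intro x hx
      by_cases hxc : c = x
      · subst hxc
        cases t with
        | nil => simp at hx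
        | cons d t' =>
          have h1 : c ≤ d := hl.1 d (by simp)
          have h2 : d ≤ c := by
            rcases List.mem_cons.1 hx with h | h
            · exact h.ge
            · exact (List.pairwise_cons.1 hl.2).1 c h
          have := le_antisymm h1 h2
          subst this
          simp
      · rw [List.erase_cons_tail (by simpa using hxc)]
    have hmap : (t.map fun x => alternatingSign b ((c :: t).erase x)) =
        t.map fun x => if (ofLex c).2 = b then alternatingSign (!b) (t.erase x) else 0 :=
      List.map_congr_left fun x hx => by rw [key x hx, alternatingSign]
    rw [List.map_cons, List.sum_cons, hmap, List.erase_cons_head]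
    by_cases hcb : (ofLex c).2 = b
    · simp only [hcb, if_true, ih (!b) hl.2, alternatingSign, Bool.not_not]
      rw [if_neg (by simp), add_comm (alternatingSign (!b) t), ← add_assoc, CharTwo.add_self_eq_zero,
        zero_add, add_zero]
    · have hcb' : (ofLex c).2 = !b := Bool.eq_not_of_ne hcb
      simp [hcb', alternatingSign]

/-- The indicator of the multisets of labels which, sorted by absolute value, alternate in sign and
start with `b`. -/
def alternatingWeight (b : Bool) (M : Multiset SignedLabel) : ZMod 2 :=
  alternatingSign b (M.sort (· ≤ ·))

theorem sort_erase (M : Multiset SignedLabel) (x : SignedLabel) :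
    (M.erase x).sort (· ≤ ·) = (M.sort (· ≤ ·)).erase x := by
  refine List.Perm.eq_of_pairwise' (r := (· ≤ ·)) (Multiset.pairwise_sort _ _)
    ((Multiset.pairwise_sort _ _).sublist List.erase_sublist) ?_
  rw [← Multiset.coe_eq_coe, Multiset.sort_eq]
  conv_lhs => rw [← Multiset.sort_eq M (· ≤ ·), Multiset.coe_erase]
  congr!

theorem sum_alternatingWeight_erase {ι : Type*} [DecidableEq ι] (b : Bool) (T : Finset ι)
    (f : ι → SignedLabel) :
    ∑ i ∈ T, alternatingWeight b ((T.erase i).val.map f) =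
      alternatingWeight b (T.val.map f) + alternatingWeight (!b) (T.val.map f) := by
  have h := alternatingSign_sum_erase b ((T.val.map f).sort (· ≤ ·)) (Multiset.pairwise_sort _ _)
  unfold alternatingWeight
  rw [← h]
  have h2 : ∀ i ∈ T, alternatingSign b (((T.erase i).val.map f).sort (· ≤ ·)) =
      alternatingSign b (((T.val.map f).sort (· ≤ ·)).erase (f i)) := by
    intro i hi
    rw [← sort_erase, Finset.erase_val, Multiset.map_erase_of_mem _ _ hi]
  rw [Finset.sum_congr rfl h2, Finset.sum, ← Multiset.sum_coe, ← Multiset.map_coe,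
    Multiset.sort_eq, Multiset.map_map]
  rfl

theorem alternatingSign_map_flip (b : Bool) (l : List SignedLabel) :
    alternatingSign b (l.map SignedLabel.flip) = alternatingSign (!b) l := by
  induction l generalizing b with
  | nil => rfl
  | cons c t ih =>
    simp only [List.map_cons, alternatingSign, ih, SignedLabel.flip, ofLex_toLex]
    cases b <;> cases (ofLex c).2 <;> simp

/-- Flipping could reorder only labels of equal absolute value and different sign; `hM` excludes
such pairs, so the sorted list stays sorted. -/
theorem alternatingWeight_map_flip (b : Bool) (M : Multiset SignedLabel)
    (hM : ∀ x ∈ M, ∀ y ∈ M, x ≠ y.flip) :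
    alternatingWeight b (M.map SignedLabel.flip) = alternatingWeight (!b) M := by
  unfold alternatingWeight
  rw [← alternatingSign_map_flip]
  congr 1
  refine List.Perm.eq_of_pairwise' (r := (· ≤ ·)) (Multiset.pairwise_sort _ _) ?_ ?_
  · rw [List.pairwise_map]
    refine (Multiset.pairwise_sort M (· ≤ ·)).imp_of_mem ?_
    intro x y hx hy hxy
    have hne := hM x (by simpa using hx) y (by simpa using hy)
    rw [Prod.Lex.le_iff] at hxy ⊢
    rcases hxy with h | ⟨h1, h2⟩
    · exact Or.inl h
    · refine Or.inr ⟨h1, ?_⟩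
      have : (ofLex x).2 = (ofLex y).2 := by
        by_contra hc
        apply hne
        apply ofLex.injective
        refine Prod.ext h1 ?_
        exact Bool.eq_not_of_ne hc
      simp [SignedLabel.flip, this]
  · rw [← Multiset.coe_eq_coe, Multiset.sort_eq, ← Multiset.map_coe, Multiset.sort_eq]

/-- Neighbours have different signs, so equal absolute values would make them opposite labels,
against `hc`. -/
theorem pairwise_lt_of_alternatingSign_ne_zero (b : Bool) (l : List SignedLabel)
    (hl : l.Pairwise (· ≤ ·)) (hc : ∀ x ∈ l, ∀ y ∈ l, x ≠ y.flip)
    (h : alternatingSign b l ≠ 0) : (l.map fun x => (ofLex x).1).Pairwise (· < ·) := by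
  rw [List.pairwise_map]
  induction l generalizing b with
  | nil => simp
  | cons c t ih =>
    rw [alternatingSign] at h
    split_ifs at h with hcb
    · rw [List.pairwise_cons] at hl ⊢
      refine ⟨?_, ih _ hl.2 (fun x hx y hy => hc x (by simp [hx]) y (by simp [hy])) h⟩
      cases t with
      | nil => simp
      | cons d t' =>
        have hcd : (ofLex c).1 < (ofLex d).1 := by
          rw [alternatingSign] at h
          split_ifs at h with hdb
          · have := hl.1 d (by simp)
            rw [Prod.Lex.le_iff] at this
            rcases this with h' | ⟨h1, -⟩
            · exact h'
            · exfalso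
              apply hc c (by simp) d (by simp)
              apply ofLex.injective
              refine Prod.ext h1 ?_
              simp [SignedLabel.flip, hcb, hdb]
          · simp at h
        intro x hx
        rcases List.mem_cons.1 hx with rfl | hx
        · exact hcd
        · have := (List.pairwise_cons.1 hl.2).1 x hx
          rw [Prod.Lex.le_iff] at this
          rcases this with h' | ⟨h1, -⟩
          · exact hcd.trans h'
          · exact h1 ▸ hcd
    · simp at h

theorem card_le_of_alternatingWeight_ne_zero (b : Bool) (M : Multiset SignedLabel) (m : ℕ)
    (hM : ∀ x ∈ M, (ofLex x).1 < m) (hc : ∀ x ∈ M, ∀ y ∈ M, x ≠ y.flip)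
    (h : alternatingWeight b M ≠ 0) : M.card ≤ m := by
  have h1 := pairwise_lt_of_alternatingSign_ne_zero b (M.sort (· ≤ ·)) (Multiset.pairwise_sort _ _)
    (by simpa using hc) h
  have h2 : ((M.sort (· ≤ ·)).map fun x => (ofLex x).1).Nodup := h1.imp (fun h => h.ne)
  have h3 := (h2.subperm (l₂ := List.range m) (by
    intro x hx
    simp only [List.mem_map, Multiset.mem_sort] at hx
    obtain ⟨y, hy, rfl⟩ := hx
    simpa using hM y hy)).length_le
  simpa using h3

/-! ### Signed permutations as maximal chains of sign vectors -/

/-- The `i`-th member of the maximal chain of sign vectors described by a signed permutation: the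
coordinates `s.1 0, …, s.1 i` carry the signs given by `s.2`, the others are `0`. -/
def chainVec {N : ℕ} (s : Equiv.Perm (Fin N) × (Fin N → Bool)) (i : ℕ) : Fin N → SignType :=
  fun j => if (s.1.symm j : ℕ) ≤ i then (if s.2 j then 1 else -1) else 0

/-- The signed permutations that are trivial from the coordinate `d` on. -/
def signedPerms (N d : ℕ) : Finset (Equiv.Perm (Fin N) × (Fin N → Bool)) :=
  Finset.univ.filter fun s => ∀ j : Fin N, d ≤ j → s.1 j = j ∧ s.2 j = true

theorem mem_signedPerms {N d : ℕ} {s : Equiv.Perm (Fin N) × (Fin N → Bool)} :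
    s ∈ signedPerms N d ↔ ∀ j : Fin N, d ≤ j → s.1 j = j ∧ s.2 j = true := by
  simp [signedPerms]

theorem chainVec_ne_zero {N : ℕ} (hN : 0 < N) (s : Equiv.Perm (Fin N) × (Fin N → Bool)) (i : ℕ) :
    chainVec s i ≠ 0 := by
  intro h
  have := congrFun h (s.1 ⟨0, hN⟩)
  simp only [chainVec, Equiv.symm_apply_apply, Nat.zero_le, if_true, Pi.zero_apply] at this
  split_ifs at this

theorem chainVec_mono {N : ℕ} (s : Equiv.Perm (Fin N) × (Fin N → Bool)) {i i' : ℕ} (h : i ≤ i')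
    (j : Fin N) (hj : chainVec s i j ≠ 0) : chainVec s i' j = chainVec s i j := by
  unfold chainVec at hj ⊢
  by_cases h1 : (s.1.symm j : ℕ) ≤ i
  · rw [if_pos h1, if_pos (h1.trans h)]
  · simp [h1] at hj

theorem chainVec_swap {N i : ℕ} (hi : i + 1 < N) (s : Equiv.Perm (Fin N) × (Fin N → Bool)) {j : ℕ}
    (hj : j ≠ i) :
    chainVec (s.1 * Equiv.swap ⟨i, by omega⟩ ⟨i + 1, hi⟩, s.2) j = chainVec s j := by
  funext x
  have h : (((s.1 * Equiv.swap ⟨i, by omega⟩ ⟨i + 1, hi⟩ : Equiv.Perm (Fin N)).symm x : Fin N) : ℕ)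
      ≤ j ↔ (s.1.symm x : ℕ) ≤ j := by
    change ((Equiv.swap (⟨i, by omega⟩ : Fin N) ⟨i + 1, hi⟩).symm (s.1.symm x) : ℕ) ≤ j ↔ _
    rw [Equiv.symm_swap, Equiv.swap_apply_def]
    split_ifs with h1 h2
    · rw [h1]; simp only; omega
    · rw [h2]; simp only; omega
    · rfl
  simp only [chainVec, h]

theorem chainVec_flip {N d : ℕ} (hd : d < N) (s : Equiv.Perm (Fin N) × (Fin N → Bool)) {j : ℕ}
    (hj : j < d) (c : Bool) :
    chainVec (s.1, Function.update s.2 (s.1 ⟨d, hd⟩) c) j = chainVec s j := by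
  funext x
  by_cases hx : x = s.1 ⟨d, hd⟩
  · subst hx
    simp [chainVec, not_le.2 hj]
  · simp [chainVec, Function.update_of_ne hx]

theorem chainVec_neg {N d : ℕ} {s : Equiv.Perm (Fin N) × (Fin N → Bool)}
    (hs : s ∈ signedPerms N (d + 1)) {j : ℕ} (hj : j ≤ d) :
    chainVec (s.1, fun x : Fin N => if (x : ℕ) ≤ d then !s.2 x else s.2 x) j = -chainVec s j := by
  rw [mem_signedPerms] at hs
  funext x
  simp only [chainVec, Pi.neg_apply]
  by_cases hx : (x : ℕ) ≤ d
  · simp only [hx, if_true]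
    cases s.2 x <;> by_cases h : (s.1.symm x : ℕ) ≤ j <;> simp [h]
  · have h1 : s.1.symm x = x := by
      rw [Equiv.symm_apply_eq]
      exact (hs x (by omega)).1.symm
    have h2 : ¬ (x : ℕ) ≤ j := by omega
    simp [h1, h2]

/-! ### Ky Fan's parity count and Tucker's lemma -/

section Tucker

variable {N : ℕ} (lab : (Fin N → SignType) → SignedLabel)

/-- The indicator that the labels of the members `i ∈ T` of a chain alternate, starting with the
sign `b`. -/
def chainWeight (b : Bool) (T : Finset ℕ) (s : Equiv.Perm (Fin N) × (Fin N → Bool)) : ZMod 2 :=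
  alternatingWeight b (T.val.map fun i => lab (chainVec s i))

theorem chainWeight_congr (b : Bool) (T : Finset ℕ)
    {s s' : Equiv.Perm (Fin N) × (Fin N → Bool)} (h : ∀ i ∈ T, chainVec s i = chainVec s' i) :
    chainWeight lab b T s = chainWeight lab b T s' := by
  unfold chainWeight
  congr 1
  exact Multiset.map_congr rfl fun i hi => by rw [h i hi]

theorem chain_labels_not_flip (hN : 0 < N)
    (hcomp : ∀ X Y : Fin N → SignType, X ≠ 0 → (∀ j, X j ≠ 0 → Y j = X j) →
      lab X ≠ (lab Y).flip) (T : Finset ℕ) (s : Equiv.Perm (Fin N) × (Fin N → Bool)) :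
    ∀ x ∈ T.val.map fun i => lab (chainVec s i), ∀ y ∈ T.val.map fun i => lab (chainVec s i),
      x ≠ y.flip := by
  intro x hx y hy
  obtain ⟨i, -, rfl⟩ := Multiset.mem_map.1 hx
  obtain ⟨i', -, rfl⟩ := Multiset.mem_map.1 hy
  rcases le_total i i' with h | h
  · exact hcomp _ _ (chainVec_ne_zero hN s i) (chainVec_mono s h)
  · intro he
    refine hcomp _ _ (chainVec_ne_zero hN s i') (chainVec_mono s h) ?_
    rw [he]
    simp [SignedLabel.flip]

/-- A chain with an inner member removed has exactly two completions, obtained by exchanging the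
coordinates added at steps `i` and `i + 1`; both lie in the same hemisphere and cancel modulo 2. -/
theorem sum_chainWeight_erase_lt {d i : ℕ} (hd : d < N) (hi : i < d) (b : Bool) :
    ∑ s ∈ (signedPerms N (d + 1)).filter (fun s => s.2 ⟨d, hd⟩ = true),
      chainWeight lab b ((Finset.range (d + 1)).erase i) s = 0 := by
  refine Finset.sum_involution
    (fun s _ => (s.1 * Equiv.swap ⟨i, by omega⟩ ⟨i + 1, by omega⟩, s.2)) ?_ ?_ ?_ ?_
  · intro s _
    rw [chainWeight_congr lab b _ (s := (s.1 * _, s.2)) (s' := s)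
      fun j hj => chainVec_swap (by omega) s (Finset.ne_of_mem_erase hj)]
    exact CharTwo.add_self_eq_zero _
  · intro s _ _ h
    have h1 := congrArg Prod.fst h
    simp only [mul_eq_left, Equiv.swap_eq_one_iff, Fin.mk.injEq] at h1
    omega
  · intro s hs
    simp only [Finset.mem_filter, mem_signedPerms] at hs ⊢
    refine ⟨fun j hj => ⟨?_, (hs.1 j hj).2⟩, hs.2⟩
    rw [Equiv.Perm.mul_apply, Equiv.swap_apply_of_ne_of_ne]
    · exact (hs.1 j hj).1
    · intro h; rw [h] at hj; simp only at hj; omega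
    · intro h; rw [h] at hj; simp only at hj; omega
  · intro s _
    simp [mul_assoc]

/-- If the last coordinate added is not `d`, reversing its sign stays in the hemisphere and cancels
the term. The remaining chains form the equator, a sphere of one dimension less. -/
theorem sum_chainWeight_erase_last {d : ℕ} (hd : d < N) (b : Bool) :
    ∑ s ∈ (signedPerms N (d + 1)).filter (fun s => s.2 ⟨d, hd⟩ = true),
      chainWeight lab b (Finset.range d) s =
    ∑ s ∈ signedPerms N d, chainWeight lab b (Finset.range d) s := by
  rw [← Finset.sum_filter_add_sum_filter_not _ (fun s => s.1 ⟨d, hd⟩ = ⟨d, hd⟩)]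
  have h0 : ∑ s ∈ ((signedPerms N (d + 1)).filter (fun s => s.2 ⟨d, hd⟩ = true)).filter
      (fun s => ¬ s.1 ⟨d, hd⟩ = ⟨d, hd⟩), chainWeight lab b (Finset.range d) s = 0 := by
    refine Finset.sum_involution
      (fun s _ => (s.1, Function.update s.2 (s.1 ⟨d, hd⟩) (!s.2 (s.1 ⟨d, hd⟩)))) ?_ ?_ ?_ ?_
    · intro s _
      rw [chainWeight_congr lab b _ (s := (s.1, Function.update s.2 _ _)) (s' := s)
        fun j hj => chainVec_flip hd s (Finset.mem_range.1 hj) _]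
      exact CharTwo.add_self_eq_zero _
    · intro s _ _ h
      have h1 := congrFun (congrArg Prod.snd h) (s.1 ⟨d, hd⟩)
      simp at h1
    · intro s hs
      simp only [Finset.mem_filter, mem_signedPerms] at hs ⊢
      obtain ⟨⟨h1, h2⟩, h3⟩ := hs
      refine ⟨⟨fun j hj => ⟨(h1 j hj).1, ?_⟩, ?_⟩, h3⟩
      · rw [Function.update_of_ne]
        · exact (h1 j hj).2
        · intro h
          have h4 : (⟨d, hd⟩ : Fin N) = j := s.1.injective (h.symm.trans (h1 j hj).1.symm)
          rw [← h4] at hj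
          simp at hj
      · rw [Function.update_of_ne (Ne.symm h3)]
        exact h2
    · intro s _
      simp
  rw [h0, add_zero]
  congr 1
  ext s
  simp only [Finset.mem_filter, mem_signedPerms]
  constructor
  · rintro ⟨⟨h1, h2⟩, h3⟩ j hj
    rcases hj.eq_or_lt with h | h
    · have : (⟨d, hd⟩ : Fin N) = j := Fin.ext h
      rw [← this]
      exact ⟨h3, h2⟩
    · exact h1 j h
  · intro h
    exact ⟨⟨fun j hj => h j (by omega), (h ⟨d, hd⟩ le_rfl).2⟩, (h ⟨d, hd⟩ le_rfl).1⟩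

/-- The antipodal map exchanges the hemispheres and flips every label, hence also the starting sign.
-/
theorem sum_chainWeight_hemisphere
    (hanti : ∀ X : Fin N → SignType, X ≠ 0 → lab (-X) = (lab X).flip)
    (hcomp : ∀ X Y : Fin N → SignType, X ≠ 0 → (∀ j, X j ≠ 0 → Y j = X j) →
      lab X ≠ (lab Y).flip) {d : ℕ} (hd : d < N) (b : Bool) :
    ∑ s ∈ (signedPerms N (d + 1)).filter (fun s => s.2 ⟨d, hd⟩ = true),
      chainWeight lab (!b) (Finset.range (d + 1)) s =
    ∑ s ∈ (signedPerms N (d + 1)).filter (fun s => ¬ s.2 ⟨d, hd⟩ = true),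
      chainWeight lab b (Finset.range (d + 1)) s := by
  have hmem : ∀ s ∈ signedPerms N (d + 1),
      (s.1, fun x : Fin N => if (x : ℕ) ≤ d then !s.2 x else s.2 x) ∈ signedPerms N (d + 1) := by
    intro s hs
    rw [mem_signedPerms] at hs ⊢
    intro j hj
    have : ¬ (j : ℕ) ≤ d := by omega
    simpa [this] using hs j hj
  refine Finset.sum_bij'
    (fun s _ => (s.1, fun x : Fin N => if (x : ℕ) ≤ d then !s.2 x else s.2 x))
    (fun s _ => (s.1, fun x : Fin N => if (x : ℕ) ≤ d then !s.2 x else s.2 x)) ?_ ?_ ?_ ?_ ?_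
  · intro s hs
    rw [Finset.mem_filter] at hs ⊢
    exact ⟨hmem s hs.1, by simp [hs.2]⟩
  · intro s hs
    rw [Finset.mem_filter] at hs ⊢
    exact ⟨hmem s hs.1, by simp [hs.2]⟩
  · intro s _
    refine Prod.ext rfl (funext fun x => ?_)
    simp only
    split_ifs <;> simp
  · intro s _
    refine Prod.ext rfl (funext fun x => ?_)
    simp only
    split_ifs <;> simp
  · intro s hs
    have hs' := (Finset.mem_filter.1 hs).1
    unfold chainWeight
    rw [← alternatingWeight_map_flip b _
      (chain_labels_not_flip lab (by omega) hcomp (Finset.range (d + 1)) s), Multiset.map_map]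
    congr 1
    refine Multiset.map_congr rfl fun i hi => ?_
    rw [chainVec_neg hs' (Nat.lt_succ_iff.1 (Finset.mem_range.1 hi)),
      hanti _ (chainVec_ne_zero (by omega) s i)]
    rfl

/-- Ky Fan's parity theorem for the barycentric subdivision of the cross-polytope. -/
theorem sum_chainWeight_eq_one
    (hanti : ∀ X : Fin N → SignType, X ≠ 0 → lab (-X) = (lab X).flip)
    (hcomp : ∀ X Y : Fin N → SignType, X ≠ 0 → (∀ j, X j ≠ 0 → Y j = X j) →
      lab X ≠ (lab Y).flip) {d : ℕ} (hd : d ≤ N) :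
    ∑ s ∈ signedPerms N d, chainWeight lab true (Finset.range d) s = 1 := by
  induction d with
  | zero =>
    have : signedPerms N 0 = {(1, fun _ => true)} := by
      ext s
      simp only [mem_signedPerms, Nat.zero_le, true_imp_iff, Finset.mem_singleton]
      constructor
      · intro h
        exact Prod.ext (Equiv.ext fun j => (h j).1) (funext fun j => (h j).2)
      · rintro rfl j
        simp
    rw [this, Finset.sum_singleton]
    simp [chainWeight, alternatingWeight, alternatingSign]
  | succ d ih =>
    have hd' : d < N := hd
    -- Folding the lower hemisphere onto the upper one counts each upper facet with both starting
    -- signs, which is the right side of the deletion identity.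
    rw [← Finset.sum_filter_add_sum_filter_not _ (fun s => s.2 ⟨d, hd'⟩ = true),
      ← sum_chainWeight_hemisphere lab hanti hcomp hd', ← Finset.sum_add_distrib]
    have h1 : ∀ s, chainWeight lab true (Finset.range (d + 1)) s +
        chainWeight lab (!true) (Finset.range (d + 1)) s =
        ∑ i ∈ Finset.range (d + 1), chainWeight lab true ((Finset.range (d + 1)).erase i) s :=
      fun s => (sum_alternatingWeight_erase true (Finset.range (d + 1))
        fun i => lab (chainVec s i)).symm
    rw [Finset.sum_congr rfl fun s _ => h1 s, Finset.sum_comm, Finset.sum_range_succ,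
      Finset.sum_eq_zero fun i hi =>
        sum_chainWeight_erase_lt lab hd' (Finset.mem_range.1 hi) true, zero_add]
    have h2 : (Finset.range (d + 1)).erase d = Finset.range d := by
      rw [Finset.range_add_one, Finset.erase_insert (by simp)]
    rw [h2, sum_chainWeight_erase_last lab hd' true, ih hd'.le]

/-- The octahedral Tucker lemma. -/
theorem octahedral_tucker (m : ℕ)
    (hlt : ∀ X : Fin N → SignType, X ≠ 0 → (ofLex (lab X)).1 < m)
    (hanti : ∀ X : Fin N → SignType, X ≠ 0 → lab (-X) = (lab X).flip)
    (hcomp : ∀ X Y : Fin N → SignType, X ≠ 0 → (∀ j, X j ≠ 0 → Y j = X j) →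
      lab X ≠ (lab Y).flip) : N ≤ m := by
  rcases Nat.eq_zero_or_pos N with h0 | hN
  · omega
  have h := sum_chainWeight_eq_one lab hanti hcomp le_rfl
  obtain ⟨s, -, hs⟩ := Finset.exists_ne_zero_of_sum_ne_zero (h.trans_ne one_ne_zero)
  have := card_le_of_alternatingWeight_ne_zero true _ m ?_
    (chain_labels_not_flip lab hN hcomp (Finset.range N) s) hs
  · simpa using this
  · intro x hx
    obtain ⟨i, -, rfl⟩ := Multiset.mem_map.1 hx
    exact hlt _ (chainVec_ne_zero hN s i)

end Tucker

/-! ### Alternation of sign vectors and the general lower bound -/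

/-- The sign vector `X` has an alternating subsequence of length `k` that starts with `1`. -/
def HasAlt {N : ℕ} (X : Fin N → SignType) (k : ℕ) : Prop :=
  ∃ a : Fin k → Fin N, StrictMono a ∧ ∀ i, X (a i) = (-1) ^ (i : ℕ)

section Alternation

variable {N : ℕ} {X Y : Fin N → SignType} {k : ℕ}

theorem HasAlt.mono (h : ∀ j, X j ≠ 0 → Y j = X j) (hX : HasAlt X k) : HasAlt Y k := by
  obtain ⟨a, ha, hs⟩ := hX
  refine ⟨a, ha, fun i => ?_⟩
  rw [h _ (by rw [hs]; exact pow_ne_zero _ (by decide)), hs]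

theorem neg_extends (h : ∀ j, X j ≠ 0 → Y j = X j) : ∀ j, (-X) j ≠ 0 → (-Y) j = (-X) j := by
  intro j hj
  simp only [Pi.neg_apply, ne_eq, SignType.neg_eq_zero_iff] at hj ⊢
  rw [h j hj]

theorem HasAlt.of_le {k' : ℕ} (h : k' ≤ k) (hX : HasAlt X k) : HasAlt X k' := by
  obtain ⟨a, ha, hs⟩ := hX
  exact ⟨fun i => a (Fin.castLE h i), fun i j hij => ha (by simpa using hij), fun i => by
    simpa using hs (Fin.castLE h i)⟩

theorem HasAlt.le (hX : HasAlt X k) : k ≤ N := by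
  obtain ⟨a, ha, -⟩ := hX
  simpa using Fintype.card_le_of_injective a ha.injective

theorem hasAlt_zero (X : Fin N → SignType) : HasAlt X 0 :=
  ⟨Fin.elim0, fun i => i.elim0, fun i => i.elim0⟩

theorem HasAlt.cons {p : Fin N} {a : Fin k → Fin N} (ha : StrictMono a)
    (hs : ∀ i, (-X) (a i) = (-1) ^ (i : ℕ)) (hp : X p = 1) (hlt : ∀ i, p < a i) :
    HasAlt X (k + 1) := by
  refine ⟨Fin.cons p a, ?_, ?_⟩
  · intro i j hij
    cases j using Fin.cases with
    | zero => simp at hij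
    | succ j =>
      cases i using Fin.cases with
      | zero => simpa using hlt j
      | succ i => simpa using ha (by simpa using hij)
  · intro i
    cases i using Fin.cases with
    | zero => simpa using hp
    | succ i =>
      have := hs i
      simp only [Pi.neg_apply] at this
      simp [pow_succ, ← this]

/-- The first entry of whichever sequence starts further left can be put in front of the other. So
at the maximal length only one starting sign occurs, and that sign can serve as a label. -/
theorem HasAlt.succ_of_neg (hk : 1 ≤ k) (h1 : HasAlt X k) (h2 : HasAlt (-X) k) :
    HasAlt X (k + 1) ∨ HasAlt (-X) (k + 1) := by
  obtain ⟨a, ha, has⟩ := h1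
  obtain ⟨b, hb, hbs⟩ := h2
  have ha0 : X (a ⟨0, hk⟩) = 1 := by simpa using has ⟨0, hk⟩
  have hb0 : (-X) (b ⟨0, hk⟩) = 1 := by simpa using hbs ⟨0, hk⟩
  rcases lt_trichotomy (a ⟨0, hk⟩) (b ⟨0, hk⟩) with h | h | h
  · exact Or.inl (HasAlt.cons hb hbs ha0 fun i => h.trans_le (hb.monotone (Fin.mk_le_of_le_val
      (Nat.zero_le _))))
  · rw [← h, Pi.neg_apply, ha0] at hb0
    exact absurd hb0 (by decide)
  · refine Or.inr (HasAlt.cons ha (fun i => ?_) hb0 fun i => h.trans_le (ha.monotone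
      (Fin.mk_le_of_le_val (Nat.zero_le _))))
    rw [neg_neg]
    exact has i

open Classical in
/-- The length of a longest alternating subsequence of a sign vector. -/
noncomputable def altLen {N : ℕ} (X : Fin N → SignType) : ℕ :=
  Nat.findGreatest (fun k => HasAlt X k ∨ HasAlt (-X) k) N

theorem altLen_neg (X : Fin N → SignType) : altLen (-X) = altLen X := by
  unfold altLen
  congr 1
  funext k
  rw [neg_neg, or_comm]

theorem altLen_spec (X : Fin N → SignType) : HasAlt X (altLen X) ∨ HasAlt (-X) (altLen X) := by
  classical
  exact Nat.findGreatest_spec (P := fun k => HasAlt X k ∨ HasAlt (-X) k) (Nat.zero_le N)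
    (Or.inl (hasAlt_zero X))

theorem le_altLen (h : HasAlt X k ∨ HasAlt (-X) k) : k ≤ altLen X := by
  classical
  exact Nat.le_findGreatest (h.elim HasAlt.le HasAlt.le) h

theorem one_le_altLen (hX : X ≠ 0) : 1 ≤ altLen X := by
  obtain ⟨j, hj⟩ := Function.ne_iff.1 hX
  apply le_altLen
  have h : X j = 1 ∨ (-X) j = 1 := by
    rw [Pi.zero_apply] at hj
    rw [Pi.neg_apply]
    revert hj
    generalize X j = x
    revert x
    decide
  have hm : StrictMono fun _ : Fin 1 => j := fun a b hab => by omega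
  exact h.imp (fun h => ⟨fun _ => j, hm, fun i => by simp [h]⟩)
    fun h => ⟨fun _ => j, hm, fun i => by rw [h]; simp⟩

theorem not_hasAlt_altLen_neg (hX : X ≠ 0) : ¬ (HasAlt X (altLen X) ∧ HasAlt (-X) (altLen X)) := by
  rintro ⟨h1, h2⟩
  have := le_altLen (h1.succ_of_neg (one_le_altLen hX) h2)
  omega

theorem altLen_mono (h : ∀ j, X j ≠ 0 → Y j = X j) : altLen X ≤ altLen Y :=
  le_altLen ((altLen_spec X).imp (HasAlt.mono h) (HasAlt.mono (neg_extends h)))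

/-- If every sign vector with an alternating subsequence of length `r + 1` has, up to a sign, one of
`c` monotone properties, none of which can hold for two opposite vectors, then the dimension is at
most `r + c`. -/
theorem le_add_of_alternation_cover (R : (Fin N → SignType) → ℕ → Prop) (r c : ℕ)
    (hmono : ∀ X Y, (∀ j, X j ≠ 0 → Y j = X j) → ∀ t, R X t → R Y t)
    (hdisj : ∀ X t, R X t → ¬ R (-X) t)
    (hcov : ∀ X, HasAlt X (r + 1) → ∃ t < c, R X t ∨ R (-X) t) : N ≤ r + c := by
  classical
  let low (X : Fin N → SignType) : ℕ := sInf {t | R X t ∨ R (-X) t}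
  have low_neg : ∀ X, low (-X) = low X := by
    intro X
    simp only [low, neg_neg]
    congr 1
    ext t
    exact or_comm
  have low_spec : ∀ X, ¬ altLen X ≤ r → low X < c ∧ (R X (low X) ∨ R (-X) (low X)) := by
    intro X hX
    have : ∃ t < c, R X t ∨ R (-X) t := by
      rcases altLen_spec X with h | h
      · exact hcov X (h.of_le (by omega))
      · obtain ⟨t, ht, h'⟩ := hcov (-X) (h.of_le (by omega))
        rw [neg_neg] at h'
        exact ⟨t, ht, h'.symm⟩
    obtain ⟨t, ht, h⟩ := this
    exact ⟨(Nat.sInf_le (s := {t | R X t ∨ R (-X) t}) h).trans_lt ht,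
      Nat.sInf_mem (s := {t | R X t ∨ R (-X) t}) ⟨t, h⟩⟩
  -- For nonzero `X` the first branch has absolute values in `[0, r)`, the second in `[r, r + c)`,
  -- so labels from different branches are never opposite. The set defining `low` is nonempty
  -- whenever the second branch applies.
  let lab (X : Fin N → SignType) : SignedLabel :=
    if altLen X ≤ r then toLex (altLen X - 1, decide (HasAlt X (altLen X)))
    else toLex (r + low X, decide (R X (low X)))
  refine octahedral_tucker lab (r + c) ?_ ?_ ?_
  · intro X hX
    simp only [lab]
    have := one_le_altLen hX
    split_ifs with h
    · simp only [ofLex_toLex]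
      omega
    · have := (low_spec X h).1
      simp only [ofLex_toLex]
      omega
  · intro X hX
    simp only [lab, altLen_neg, low_neg]
    split_ifs with h
    · simp only [SignedLabel.flip, ofLex_toLex, ← decide_not]
      congr 3
      have h1 := altLen_spec X
      have h2 := not_hasAlt_altLen_neg hX
      exact propext ⟨fun h h' => h2 ⟨h', h⟩, fun h => h1.resolve_left h⟩
    · simp only [SignedLabel.flip, ofLex_toLex, ← decide_not]
      congr 3
      have h1 := (low_spec X h).2
      have h2 := hdisj X (low X)
      exact propext ⟨fun h h' => h2 h' h, fun h => h1.resolve_left h⟩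
  · intro X Y hX hXY heq
    have hY : Y ≠ 0 := by
      obtain ⟨j, hj⟩ := Function.ne_iff.1 hX
      intro h0
      have := hXY j hj
      rw [h0] at this
      exact hj this.symm
    have hle := altLen_mono hXY
    have h1 := one_le_altLen hX
    have heq1 := congrArg (fun x => (ofLex x).1) heq
    have heq2 := congrArg (fun x => (ofLex x).2) heq
    simp only [lab, SignedLabel.flip] at heq1 heq2
    by_cases hXr : altLen X ≤ r
    · by_cases hYr : altLen Y ≤ r
      · simp only [hXr, hYr, if_true, ofLex_toLex] at heq1 heq2
        have he : altLen X = altLen Y := by omega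
        rw [he, ← decide_not, decide_eq_decide] at heq2
        have h2 := not_hasAlt_altLen_neg hY
        rcases altLen_spec X with h | h
        · rw [he] at h
          exact heq2.1 h (h.mono hXY)
        · rw [he] at h
          by_cases hYa : HasAlt Y (altLen Y)
          · exact h2 ⟨hYa, h.mono (neg_extends hXY)⟩
          · exact hYa ((heq2.2 hYa).mono hXY)
      · simp only [hXr, hYr, if_true, if_false, ofLex_toLex] at heq1
        omega
    · have hYr : ¬ altLen Y ≤ r := by omega
      simp only [hXr, hYr, if_false, ofLex_toLex] at heq1 heq2
      have he : low X = low Y := by omega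
      rw [he, ← decide_not, decide_eq_decide] at heq2
      have h3 := (low_spec X hXr).2
      rw [he] at h3
      rcases h3 with h | h
      · exact heq2.1 h (hmono _ _ hXY _ h)
      · by_cases hYa : R Y (low Y)
        · exact hdisj Y _ hYa (hmono _ _ (neg_extends hXY) _ h)
        · exact hYa (hmono _ _ hXY _ (heq2.2 hYa))

end Alternation

/-! ### Upper bounds from transversals -/

theorem SimpleGraph.colorable_of_transversal {V : Type*} (G : SimpleGraph V) (f : V → Finset ℤ)
    (hf : ∀ u v, G.Adj u v → Disjoint (f u) (f v)) (S : Finset ℤ) (hS : ∀ v, ∃ x ∈ f v, x ∈ S)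
    {m : ℕ} (hm : S.card ≤ m) : G.Colorable m := by
  choose g hg hgS using hS
  have C : G.Coloring S := SimpleGraph.Coloring.mk (fun v => ⟨g v, hgS v⟩) fun {u v} huv h => by
    have h' : g u = g v := congrArg Subtype.val h
    exact Finset.disjoint_left.1 (hf u v huv) (hg u) (h' ▸ hg v)
  have := C.colorable
  rw [Fintype.card_coe] at this
  exact this.mono hm

theorem SimpleGraph.chromaticNumber_eq_of_colorable {V : Type*} {G : SimpleGraph V} {m : ℕ}
    (h : G.Colorable m) (hle : ∀ c (_ : G.Coloring (Fin c)), m ≤ c) :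
    G.chromaticNumber = (m : ℕ∞) :=
  le_antisymm h.chromaticNumber_le
    (SimpleGraph.le_chromaticNumber_iff_colorable.2 fun c hc => hle c hc.some)

theorem mem_pmSet {n : ℕ} {x : ℤ} : x ∈ pmSet n ↔ 1 ≤ x.natAbs ∧ x.natAbs ≤ n := by
  simp only [pmSet, Finset.mem_union, Finset.mem_image, Finset.mem_Icc]
  constructor
  · rintro (⟨i, hi, rfl⟩ | ⟨i, hi, rfl⟩) <;> omega
  · intro h
    rcases le_total 0 x with hx | hx
    · exact Or.inl ⟨x.natAbs, h, by omega⟩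
    · exact Or.inr ⟨x.natAbs, h, by omega⟩

theorem card_pmSet_le (n : ℕ) : (pmSet n).card ≤ 2 * n := by
  refine (Finset.card_union_le _ _).trans ?_
  have h1 := Finset.card_image_le (s := Finset.Icc 1 n) (f := fun i : ℕ => (i : ℤ))
  have h2 := Finset.card_image_le (s := Finset.Icc 1 n) (f := fun i : ℕ => -(i : ℤ))
  rw [Nat.card_Icc] at h1 h2
  omega

/-- The `k` absolute values are distinct, and only `k - 1` integers lie strictly between `n - k` and
`n`. -/
theorem IsSignedSubset.exists_mem_pmSet_or {n k : ℕ} (hk : 1 ≤ k) (hkn : k ≤ n) {A : Finset ℤ}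
    (hA : IsSignedSubset n k A) : ∃ x ∈ A, x ∈ pmSet (n - k) ∪ {(n : ℤ), -(n : ℤ)} := by
  by_contra! h
  obtain ⟨h1, h2, h3⟩ := hA
  have hinj : Set.InjOn Int.natAbs (A : Set ℤ) := by
    intro x hx y hy hxy
    rcases Int.natAbs_eq_natAbs_iff.1 hxy with h' | h'
    · exact h'
    · exact absurd (Finset.mem_image.2 ⟨y, hy, h'.symm⟩) (Finset.disjoint_left.1 h3 hx)
  have hsub : A.image Int.natAbs ⊆ Finset.Ioo (n - k) n := by
    intro y hy
    obtain ⟨x, hx, rfl⟩ := Finset.mem_image.1 hy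
    have h4 := h x hx
    have h5 := mem_pmSet.1 (h1 hx)
    simp only [Finset.mem_union, Finset.mem_insert, Finset.mem_singleton, mem_pmSet] at h4
    rw [Finset.mem_Ioo]
    omega
  have := Finset.card_le_card hsub
  rw [Finset.card_image_of_injOn hinj, h2, Nat.card_Ioo] at this
  omega

theorem KS_negGraph_colorable {n k : ℕ} (hk : 1 ≤ k) (hkn : k ≤ n) :
    (KS n k).negGraph.Colorable (2 * n - 2 * k + 2) := by
  refine SimpleGraph.colorable_of_transversal (KS n k).negGraph (fun A => A.1)
    (fun u v h => h.2) _
    (fun A => A.2.exists_mem_pmSet_or hk hkn) ?_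
  have h1 := card_pmSet_le (n - k)
  have h2 := Finset.card_union_le (pmSet (n - k)) {(n : ℤ), -(n : ℤ)}
  have h3 : ({(n : ℤ), -(n : ℤ)} : Finset ℤ).card ≤ 2 := Finset.card_le_two
  omega

theorem StrictMono.add_le_of_fin {k : ℕ} {a : Fin k → ℕ} (ha : StrictMono a) (i : Fin k) (t : ℕ)
    (h : i + t < k) : a i + t ≤ a ⟨i + t, h⟩ := by
  induction t with
  | zero => simp
  | succ t ih =>
    have h1 := ih (by omega)
    have h2 : a ⟨i + t, by omega⟩ < a ⟨i + (t + 1), h⟩ := ha (Fin.mk_lt_mk.2 (by omega))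
    omega

/-- One of the two smallest entries in absolute value is positive; the `k - 2` or more larger ones
bound it by `n - k + 2`. -/
theorem IsAlternating.exists_mem_Icc {n k : ℕ} (hk : 2 ≤ k) {A : Finset ℤ}
    (hA : IsAlternating n k A) :
    ∃ x ∈ A, x ∈ (Finset.Icc 1 (n - k + 2)).image (fun i : ℕ => (i : ℤ)) := by
  obtain ⟨a, ha, hb, h⟩ := hA
  have h0 := ha.add_le_of_fin ⟨0, by omega⟩ (k - 1) (by simp only; omega)
  have h1 := ha.add_le_of_fin ⟨1, by omega⟩ (k - 2) (by simp only; omega)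
  have h0' := (hb ⟨0 + (k - 1), by omega⟩).2
  have h1' := (hb ⟨1 + (k - 2), by omega⟩).2
  have h0'' := (hb ⟨0, by omega⟩).1
  have h1'' := (hb ⟨1, by omega⟩).1
  rcases h with rfl | rfl
  · refine ⟨a ⟨0, by omega⟩, Finset.mem_image.2 ⟨⟨0, by omega⟩, Finset.mem_univ _, by simp⟩,
      Finset.mem_image.2 ⟨_, ?_, rfl⟩⟩
    rw [Finset.mem_Icc]
    simp only at h0 h0'
    omega
  · refine ⟨a ⟨1, by omega⟩, Finset.mem_image.2 ⟨⟨1, by omega⟩, Finset.mem_univ _, by simp⟩,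
      Finset.mem_image.2 ⟨_, ?_, rfl⟩⟩
    rw [Finset.mem_Icc]
    simp only at h1 h1'
    omega

theorem SSG_negGraph_adj {n k : ℕ} {u v : alternatingSets n k} :
    (SSG n k).negGraph.Adj u v ↔ u ≠ v ∧ Disjoint u.1.1 v.1.1 := Iff.rfl

theorem SSG_negGraph_colorable {n k : ℕ} (hk : 1 ≤ k) (hkn : k ≤ n) (h : 2 ≤ k ∨ n = k) :
    (SSG n k).negGraph.Colorable (n - k + 2) := by
  rcases h with h | rfl
  · refine SimpleGraph.colorable_of_transversal (SSG n k).negGraph (fun A => A.1.1)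
      (fun u v h => (SSG_negGraph_adj.1 h).2) _ (fun A => IsAlternating.exists_mem_Icc h A.2) ?_
    refine Finset.card_image_le.trans ?_
    rw [Nat.card_Icc]
    omega
  · let f : (SSG n n).negGraph →g (KS n n).negGraph :=
      { toFun := Subtype.val
        map_rel' := fun {u v} h => ⟨fun he => h.1 (Subtype.ext he), h.2⟩ }
    have := (KS_negGraph_colorable hk hkn).of_hom f
    simpa using this

/-! ### Lower bounds from the alternation principle -/

theorem isSignedSubset_image {n k : ℕ} {a : Fin k → ℕ} (ha : StrictMono a)
    (h : ∀ i, 1 ≤ a i ∧ a i ≤ n) {s : Fin k → ℤ} (hs : ∀ i, s i = 1 ∨ s i = -1) :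
    IsSignedSubset n k (Finset.univ.image fun i => s i * (a i : ℤ)) := by
  have habs : ∀ i, (s i * (a i : ℤ)).natAbs = a i := by
    intro i
    rcases hs i with h' | h' <;> simp [h']
  refine ⟨?_, ?_, ?_⟩
  · intro x hx
    obtain ⟨i, -, rfl⟩ := Finset.mem_image.1 hx
    rw [mem_pmSet, habs]
    exact h i
  · rw [Finset.card_image_of_injective, Finset.card_univ, Fintype.card_fin]
    intro i j hij
    have := congrArg Int.natAbs hij
    simp only [habs] at this
    exact ha.injective this
  · rw [Finset.disjoint_left]
    intro x hx hx'
    obtain ⟨i, -, rfl⟩ := Finset.mem_image.1 hx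
    obtain ⟨y, hy, hxy⟩ := Finset.mem_image.1 hx'
    obtain ⟨j, -, rfl⟩ := Finset.mem_image.1 hy
    have h1 := congrArg Int.natAbs hxy
    rw [Int.natAbs_neg, habs, habs] at h1
    have h2 := ha.injective h1
    subst h2
    have h3 := (h j).1
    have h4 := habs j
    omega

theorem SignedSubset.ne_of_disjoint {n k : ℕ} (hk : 1 ≤ k) {A B : SignedSubset n k}
    (h : Disjoint A.1 B.1) : A ≠ B := by
  rintro rfl
  exact KS_no_negative_loop hk A h

theorem le_of_KS_negGraph_coloring {n k c : ℕ} (hk : 1 ≤ k)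
    (C : (KS n k).negGraph.Coloring (Fin c)) : 2 * n ≤ (2 * k - 2) + c := by
  -- Coordinates `2i` and `2i + 1` stand for `i + 1` and `-(i + 1)`.
  let σ : ℕ → ℤ := fun p => if p % 2 = 0 then 1 else -1
  refine le_add_of_alternation_cover (N := 2 * n)
    (fun X t => ∃ v, (C v : ℕ) = t ∧ ∀ x ∈ v.1, ∃ p : Fin (2 * n), X p = 1 ∧
      x = σ p * ((p / 2 + 1 : ℕ) : ℤ)) (2 * k - 2) c ?_ ?_ ?_
  · rintro X Y hXY t ⟨v, hv, h⟩
    refine ⟨v, hv, fun x hx => ?_⟩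
    obtain ⟨p, hp, hpx⟩ := h x hx
    exact ⟨p, by rw [hXY p (by rw [hp]; decide), hp], hpx⟩
  · rintro X t ⟨v, hv, h⟩ ⟨w, hw, h'⟩
    have hd : Disjoint v.1 w.1 := by
      rw [Finset.disjoint_left]
      intro x hx hx'
      obtain ⟨p, hp, rfl⟩ := h x hx
      obtain ⟨q, hq, hpq⟩ := h' _ hx'
      have : p = q := by
        apply Fin.ext
        simp only [σ] at hpq
        split_ifs at hpq <;> omega
      subst this
      rw [Pi.neg_apply, hp] at hq
      exact absurd hq (by decide)
    exact C.valid (show (KS n k).negGraph.Adj v w from ⟨SignedSubset.ne_of_disjoint hk hd, hd⟩)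
      (Fin.ext (hv.trans hw.symm))
  · rintro X ⟨a, ha, hs⟩
    have hlt : ∀ i : Fin k, 2 * (i : ℕ) < 2 * k - 2 + 1 := fun i => by omega
    -- The even-indexed terms are the positive ones; the negative term between two of them puts them
    -- at least two positions apart, hence in different pairs.
    have hmono : StrictMono fun i : Fin k => ((a ⟨2 * i, hlt i⟩ : ℕ) / 2 + 1) := by
      intro i j hij
      have hij' : (i : ℕ) < j := hij
      have h1 : a ⟨2 * i, hlt i⟩ < a ⟨2 * i + 1, by omega⟩ := ha (Fin.mk_lt_mk.2 (by omega))
      have h2 : a ⟨2 * i + 1, by omega⟩ < a ⟨2 * j, hlt j⟩ := ha (Fin.mk_lt_mk.2 (by omega))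
      rw [Fin.lt_def] at h1 h2
      simp only
      omega
    have hv := isSignedSubset_image (n := n) hmono (fun i => ⟨by omega, by omega⟩)
      (s := fun i => σ (a ⟨2 * i, hlt i⟩)) (fun i => by simp only [σ]; split_ifs <;> simp)
    refine ⟨C ⟨_, hv⟩, (C ⟨_, hv⟩).2, Or.inl ⟨⟨_, hv⟩, rfl, fun x hx => ?_⟩⟩
    obtain ⟨i, -, rfl⟩ := Finset.mem_image.1 hx
    exact ⟨a ⟨2 * i, hlt i⟩, by rw [hs]; simp, rfl⟩

theorem le_of_SSG_negGraph_coloring {n k c : ℕ} (hk : 1 ≤ k)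
    (C : (SSG n k).negGraph.Coloring (Fin c)) : n ≤ (k - 1) + (c - 1) := by
  let P (X : Fin n → SignType) (v : alternatingSets n k) : Prop :=
    ∀ x ∈ v.1.1, ∃ p : Fin n, X p = 1 ∧ x = ((p + 1 : ℕ) : ℤ) ∨ X p = -1 ∧ x = -((p + 1 : ℕ) : ℤ)
  have hne : ∀ X v w, P X v → P (-X) w → C v ≠ C w := by
    intro X v w hv hw
    have hd : Disjoint v.1.1 w.1.1 := by
      rw [Finset.disjoint_left]
      intro x hx hx'
      obtain ⟨p, hp⟩ := hv x hx
      obtain ⟨q, hq⟩ := hw x hx'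
      have : p = q := by
        apply Fin.ext
        omega
      subst this
      rw [Pi.neg_apply] at hq
      rcases hp with ⟨h1, h2⟩ | ⟨h1, h2⟩ <;> rcases hq with ⟨h3, h4⟩ | ⟨h3, h4⟩
      · rw [h1] at h3
        exact absurd h3 (by decide)
      · omega
      · omega
      · rw [h1] at h3
        exact absurd h3 (by decide)
    exact C.valid (SSG_negGraph_adj.2
      ⟨fun h => SignedSubset.ne_of_disjoint hk hd (congrArg Subtype.val h), hd⟩)
  refine le_add_of_alternation_cover (fun X t => ∃ v, (C v : ℕ) = t ∧ P X v) (k - 1) (c - 1) ?_ ?_ ?_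
  · rintro X Y hXY t ⟨v, hv, h⟩
    refine ⟨v, hv, fun x hx => ?_⟩
    obtain ⟨p, hp⟩ := h x hx
    refine ⟨p, ?_⟩
    rwa [hXY p (by rcases hp with hp | hp <;> rw [hp.1] <;> decide)]
  · rintro X t ⟨v, hv, h⟩ ⟨w, hw, h'⟩
    exact hne X v w h h' (Fin.ext (hv.trans hw.symm))
  · intro X hX
    rw [Nat.sub_add_cancel hk] at hX
    obtain ⟨a, ha, hs⟩ := hX
    have hmono : StrictMono fun i : Fin k => (a i : ℕ) + 1 := fun i j hij => by
      have := ha hij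
      rw [Fin.lt_def] at this
      simp only
      omega
    have hb : ∀ i : Fin k, 1 ≤ (a i : ℕ) + 1 ∧ (a i : ℕ) + 1 ≤ n := fun i => by omega
    have hv := isSignedSubset_image hmono hb (s := fun i => (-1) ^ (i : ℕ))
      fun i => neg_one_pow_eq_or ℤ _
    have hw := isSignedSubset_image hmono hb (s := fun i => (-1) ^ ((i : ℕ) + 1))
      fun i => neg_one_pow_eq_or ℤ _
    let v : alternatingSets n k := ⟨⟨_, hv⟩, _, hmono, hb, Or.inl rfl⟩
    let w : alternatingSets n k := ⟨⟨_, hw⟩, _, hmono, hb, Or.inr rfl⟩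
    have hPv : P X v := by
      intro x hx
      obtain ⟨i, -, rfl⟩ := Finset.mem_image.1 hx
      refine ⟨a i, ?_⟩
      rw [hs]
      rcases Nat.even_or_odd i with h | h <;> simp [h.neg_one_pow]
    have hPw : P (-X) w := by
      intro x hx
      obtain ⟨i, -, rfl⟩ := Finset.mem_image.1 hx
      refine ⟨a i, ?_⟩
      rw [Pi.neg_apply, hs]
      rcases Nat.even_or_odd i with h | h <;> simp [pow_succ, h.neg_one_pow]
    -- Of two distinct colours below `c`, the smaller is below `c - 1`.
    have hvw : (C v : ℕ) ≠ C w := fun h => hne X v w hPv hPw (Fin.ext h)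
    have h1 := (C v).2
    have h2 := (C w).2
    rcases lt_or_gt_of_ne hvw with h | h
    · exact ⟨C v, by omega, Or.inl ⟨v, rfl, hPv⟩⟩
    · exact ⟨C w, by omega, Or.inr ⟨w, rfl, hPw⟩⟩

theorem theorem14 (n k : ℕ) (hk : 1 ≤ k) (hkn : k ≤ n) :
    (KS n k).negGraph.chromaticNumber = ((2 * n - 2 * k + 2 : ℕ) : ℕ∞) ∧
      (2 ≤ k ∨ n = k →
        (SSG n k).negGraph.chromaticNumber = ((n - k + 2 : ℕ) : ℕ∞)) := by
  refine ⟨SimpleGraph.chromaticNumber_eq_of_colorable (KS_negGraph_colorable hk hkn)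
    fun c C => ?_, fun h => SimpleGraph.chromaticNumber_eq_of_colorable
    (SSG_negGraph_colorable hk hkn h) fun c C => ?_⟩
  · have := le_of_KS_negGraph_coloring hk C
    omega
  · have := le_of_SSG_negGraph_coloring hk C
    omega
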